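/- Let $K$ be an algebraically closed field of characteristic zero, let $T=(K^\times)^r$ be a torus, and let $V$ be an $n$-dimensional representation of $T$ with weights $s_1,\dots,s_n\in X^*(T)\cong\mathbb Z^r$; that is, $V$ has a basis $b_1,\dots,b_n$ such that $t\cdot b_i=\Big(\prod_{j=1}^r t_j^{s_i^j}\Big)b_i$ for all $t\in T$ and all $i$. A vector $x\in V$ is called nilpotent if $0$ lies in the Zariski closure of $T.x$, and $(T,V)$ is called visible if there are only finitely many $T$-orbits of nilpotent vectors. Regard the weights as elements of the $\mathbb Q$-vector space $X^*(T)\otimes_{\mathbb Z}\mathbb Q\cong\mathbb Q^r$, and write $\langle A\rangle$ for the $\mathbb Q$-linear span of a subset $A$ of it. Then $(T,V)$ is visible if and only if there are an integer $l\ge 0$ and a decomposition $\{1,\dots,n\}=I_0\sqcup I_1\sqcup\dots\sqcup I_l$ into pairwise disjoint subsets ($I_0$ may be empty) such that (i) $\langle s_i\mid 1\le i\le n\rangle=\bigoplus_{j=0}^l\langle s_i\mid i\in I_j\rangle$; (ii) $\dim\langle s_i\mid i\in I_0\rangle=\# I_0$, and $\dim\langle s_i\mid i\in I_j\rangle=\#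 I_j-1$ for every $j\ge 1$; (iii) for every $j\ge 1$, $0$ belongs to the interior, for the classical topology, of the convex hull of $\{s_i\mid i\in I_j\}$ in the linear span $\langle s_i\mid i\in I_j\rangle$. -/

import Mathlib

/-- The torus `(Kˣ)^r`. -/
abbrev Torus (K : Type*) [Field K] (r : ℕ) : Type _ := Fin r → Kˣ

/-- The character `t ↦ ∏ j, t_j ^ a_j` of the torus `(Kˣ)^r` attached to `a ∈ ℤ^r`; this is the
usual identification `X^*(T) ≅ ℤ^r`. -/
def Torus.character {K : Type*} [Field K] {r : ℕ} (a : Fin r → ℤ) : Torus K r →* Kˣ where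
  toFun t := ∏ j, t j ^ a j
  map_one' := by simp
  map_mul' t u := by simp [mul_zpow, Finset.prod_mul_distrib]

section Zariski

/-- The algebra of polynomial functions on the vector space `V`: the subalgebra of all functions
`V → K` generated by the linear forms. -/
def polynomialFunctionAlgebra (K V : Type*) [Field K] [AddCommGroup V] [Module K V] :
    Subalgebra K (V → K) :=
  Algebra.adjoin K (Set.range fun f : Module.Dual K V => (f : V → K))

/-- Zariski closed subsets of `V`: common zero sets of families of polynomial functions. -/
def IsZariskiClosed (K : Type*) {V : Type*} [Field K] [AddCommGroup V] [Module K V]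
    (Z : Set V) : Prop :=
  ∃ F : Set (V → K), F ⊆ polynomialFunctionAlgebra K V ∧ Z = {v | ∀ p ∈ F, p v = 0}

/-- The Zariski closure of a subset of `V`. -/
def zariskiClosure (K : Type*) {V : Type*} [Field K] [AddCommGroup V] [Module K V]
    (S : Set V) : Set V :=
  ⋂₀ {Z | IsZariskiClosed K Z ∧ S ⊆ Z}

end Zariski

namespace Representation

variable {K G V : Type*} [Field K] [Group G] [AddCommGroup V] [Module K V]

/-- The orbit `G.x`. -/
def orbitOf (ρ : Representation K G V) (x : V) : Set V := Set.range fun g => ρ g x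

/-- `x` is nilpotent if `0` lies in the Zariski closure of its orbit. -/
def IsNilpotentVector (ρ : Representation K G V) (x : V) : Prop :=
  (0 : V) ∈ zariskiClosure K (ρ.orbitOf x)

/-- A representation is visible if it has finitely many nilpotent orbits. -/
def IsVisible (ρ : Representation K G V) : Prop :=
  {O : Set V | ∃ x : V, ρ.IsNilpotentVector x ∧ O = ρ.orbitOf x}.Finite

end Representation

/-- `T = (Kˣ)^r` acts on `V = ⨁ᵢ K bᵢ` with weights `s 0, …, s (n-1)`: the basis vector `b i` is
a weight vector of weight `s i`. -/
def IsWeightBasis {K V : Type*} [Field K] [AddCommGroup V] [Module K V] {r n : ℕ}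
    (ρ : Representation K (Torus K r) V) (s : Fin n → Fin r → ℤ)
    (b : Module.Basis (Fin n) K V) : Prop :=
  ∀ (t : Torus K r) (i : Fin n), ρ t (b i) = (Torus.character (s i) t : K) • b i

/-- The image in `W_ℚ = X^*(T) ⊗ ℚ ≅ ℚ^r` of the character `a ∈ X^*(T) ≅ ℤ^r`. -/
def rationalWeight {r : ℕ} (a : Fin r → ℤ) : Fin r → ℚ := fun j => (a j : ℚ)

/-- The set `{s i | i ∈ I}` of weights with index in `I`, as a subset of `ℚ^r`. -/
def weightSet {r n : ℕ} (s : Fin n → Fin r → ℤ) (I : Finset (Fin n)) : Set (Fin r → ℚ) :=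
  (fun i => rationalWeight (s i)) '' (I : Set (Fin n))

/-- The interior, for the classical topology, of the convex hull of `A` inside the linear span
`⟨A⟩`. -/
def convexHullInterior {r : ℕ} (A : Set (Fin r → ℚ)) : Set (Fin r → ℚ) :=
  (fun w : Submodule.span ℚ A => (w : Fin r → ℚ)) ''
    interior {w : Submodule.span ℚ A | (w : Fin r → ℚ) ∈ convexHull ℚ A}

/-! Everything is read off the space R ⊆ ℚ^n of rational linear relations among the weights. Both
visibility and the existence of the decomposition are equivalent to `HasNonnegVectors` for R.

Visibility. Integral relations are the exponents of invariant Laurent monomials, and independence of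
characters shows that x is nilpotent exactly when no nonzero nonnegative relation lives on the
support of x. If the condition on R holds, the weights on the support of a nilpotent x are therefore
independent, and its orbit consists of all vectors with that support: finitely many orbits. If it
fails at d, every vector whose support is that of d is nilpotent, while the invariant Laurent
monomial of d takes infinitely many values on such vectors.

Decomposition. Under the condition, nonnegative relations of minimal support span R, and two of them
with a common support index are proportional (`HasNonnegVectors.exists_conformal`). Their supports
are the blocks I_j with j ≥ 1, and I_0 is the rest. In terms of R, (i) is stability under
restriction to blocks, (ii) says that relations on I_0 vanish and those on I_j form a line, and
(iii) supplies a nonnegative generator of that line, and follows from a positive one. -/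

/-! ### Independence and dimension of spans in terms of relations -/

section RelationSpaces

variable {k ι : Type*} [Field k]

/-- The operator setting to zero the coordinates outside `I`. -/
def restrictTo [DecidableEq ι] (I : Finset ι) : (ι → k) →ₗ[k] (ι → k) where
  toFun d i := if i ∈ I then d i else 0
  map_add' d e := by ext i; by_cases h : i ∈ I <;> simp [h]
  map_smul' c d := by ext i; by_cases h : i ∈ I <;> simp [h]

theorem restrictTo_apply [DecidableEq ι] (I : Finset ι) (d : ι → k) (i : ι) :
    restrictTo I d i = if i ∈ I then d i else 0 := rfl

/-- The space of linear relations of a finite family of vectors. -/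
def relationSpace [Fintype ι] {E : Type*} [AddCommGroup E] [Module k E] (v : ι → E) :
    Submodule k (ι → k) :=
  LinearMap.ker (Fintype.linearCombination k v)

variable [Fintype ι] {E : Type*} [AddCommGroup E] [Module k E] {v : ι → E}

theorem mem_relationSpace {d : ι → k} : d ∈ relationSpace v ↔ ∑ i, d i • v i = 0 := by
  simp [relationSpace, Fintype.linearCombination_apply]

theorem sum_coe_smul_of_supported (I : Finset ι) (d : ι → k) (hd : ∀ i, i ∉ I → d i = 0) :
    ∑ i : I, d i • v i = ∑ i, d i • v i := by
  rw [Finset.sum_coe_sort I (fun i => d i • v i)]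
  exact Finset.sum_subset (Finset.subset_univ I) (fun i _ hi => by rw [hd i hi, zero_smul])

variable [DecidableEq ι]

theorem sum_restrictTo_smul (I : Finset ι) (d : ι → k) :
    ∑ i, restrictTo I d i • v i = ∑ i ∈ I, d i • v i := by
  simp [restrictTo_apply, ite_smul, Finset.sum_ite_mem]

theorem restrictTo_mem_relationSpace {I : Finset ι} {d : ι → k} :
    restrictTo I d ∈ relationSpace v ↔ ∑ i ∈ I, d i • v i = 0 := by
  rw [mem_relationSpace, sum_restrictTo_smul]

/-- A vanishing sum of vectors from the block spans glues into a single relation. Its restriction to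
a block is again a relation, so each summand vanishes. -/
theorem iSupIndep_span_of_restrictTo_mem {κ : Type*} {I : κ → Finset ι}
    (hI : Pairwise fun j l => Disjoint (I j) (I l))
    (h : ∀ d ∈ relationSpace (k := k) v, ∀ j, restrictTo (I j) d ∈ relationSpace v) :
    iSupIndep fun j => Submodule.span k (v '' (I j : Set ι)) := by
  classical
  rw [iSupIndep_iff_finsetSum_eq_zero_imp_eq_zero]
  intro s x hx hsum j hj
  have hx' : ∀ j, ∃ c : ι → k, j ∈ s → ∑ i ∈ I j, c i • v i = x j := by
    intro j
    by_cases hj : j ∈ s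
    · obtain ⟨c, hc⟩ := (Submodule.mem_span_image_finset_iff_exists_fun' k).1 (hx j hj)
      exact ⟨c, fun _ => hc⟩
    · exact ⟨0, fun h => absurd h hj⟩
  choose c hc using hx'
  set d : ι → k := ∑ l ∈ s, restrictTo (I l) (c l) with hd
  have hdR : d ∈ relationSpace v := by
    rw [mem_relationSpace, ← hsum]
    simp only [hd, Finset.sum_apply, Finset.sum_smul]
    rw [Finset.sum_comm]
    exact Finset.sum_congr rfl fun l hl => by rw [sum_restrictTo_smul, hc l hl]
  have := restrictTo_mem_relationSpace.1 (h d hdR j)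
  rw [← hc j hj, ← this]
  refine Finset.sum_congr rfl fun i hi => ?_
  congr 1
  simp only [hd, Finset.sum_apply, restrictTo_apply]
  rw [Finset.sum_eq_single_of_mem j hj, if_pos hi]
  intro l _ hlj
  rw [if_neg]
  exact fun hil => Finset.disjoint_left.1 (hI hlj) hil hi

theorem restrictTo_mem_of_iSupIndep_span {κ : Type*} [Fintype κ] {I : κ → Finset ι}
    (hI : Pairwise fun j l => Disjoint (I j) (I l))
    (hcover : Finset.univ.biUnion I = Finset.univ)
    (h : iSupIndep fun j => Submodule.span k (v '' (I j : Set ι)))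
    {d : ι → k} (hd : d ∈ relationSpace v) (j : κ) :
    restrictTo (I j) d ∈ relationSpace v := by
  classical
  rw [restrictTo_mem_relationSpace]
  rw [iSupIndep_iff_finsetSum_eq_zero_imp_eq_zero] at h
  refine h Finset.univ (fun j => ∑ i ∈ I j, d i • v i)
    (fun l _ => (Submodule.mem_span_image_finset_iff_exists_fun' k).2 ⟨d, rfl⟩) ?_ j
    (Finset.mem_univ j)
  rw [← Finset.sum_biUnion fun a _ b _ hab => hI hab, hcover]
  exact mem_relationSpace.1 hd

/-- Extension by zero of a family indexed by `I`. -/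
theorem sum_dite_smul (I : Finset ι) (c : I → k) :
    ∑ i, (if h : i ∈ I then c ⟨i, h⟩ else 0) • v i = ∑ i : I, c i • v i := by
  rw [← Finset.sum_subset (Finset.subset_univ I)
    (fun i _ hi => by rw [dif_neg hi, zero_smul]), ← Finset.sum_coe_sort]
  exact Finset.sum_congr rfl fun i _ => by rw [dif_pos i.2]

theorem linearIndependent_coe_iff (I : Finset ι) :
    LinearIndependent k (fun i : I => v i) ↔
      ∀ d ∈ relationSpace (k := k) v, (∀ i, i ∉ I → d i = 0) → d = 0 := by
  rw [Fintype.linearIndependent_iff]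
  constructor
  · intro h d hd hdI
    ext i
    by_cases hi : i ∈ I
    · refine h (fun i => d i) ?_ ⟨i, hi⟩
      rw [sum_coe_smul_of_supported I d hdI]
      exact mem_relationSpace.1 hd
    · exact hdI i hi
  · intro h c hc i
    have := congrFun (h (fun i => if h : i ∈ I then c ⟨i, h⟩ else 0)
      (mem_relationSpace.2 (by rw [sum_dite_smul, hc])) (fun i hi => dif_neg hi)) i
    simpa using this

theorem finrank_span_image_eq_card_iff (I : Finset ι) :
    Module.finrank k (Submodule.span k (v '' (I : Set ι))) = I.card ↔
      ∀ d ∈ relationSpace (k := k) v, (∀ i, i ∉ I → d i = 0) → d = 0 := by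
  rw [← linearIndependent_coe_iff, linearIndependent_iff_card_eq_finrank_span, Set.finrank,
    Fintype.card_coe, eq_comm, Set.image_eq_range]
  rfl

/-- By rank-nullity, the dimension drops by one exactly when the relations supported in I form a
line, and the nonzero relation p then generates it. -/
theorem finrank_span_image_add_one_eq_card_iff (I : Finset ι) {p : ι → k}
    (hp : p ∈ relationSpace v) (hpI : ∀ i, i ∉ I → p i = 0) (hp0 : p ≠ 0) :
    Module.finrank k (Submodule.span k (v '' (I : Set ι))) + 1 = I.card ↔
      ∀ d ∈ relationSpace (k := k) v, (∀ i, i ∉ I → d i = 0) → ∃ t : k, t • p = d := by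
  have hker : ∀ d : ι → k, d ∈ relationSpace v → (∀ i, i ∉ I → d i = 0) →
      (fun i : I => d i) ∈ LinearMap.ker (Fintype.linearCombination k fun i : I => v i) := by
    intro d hd hdI
    rw [LinearMap.mem_ker, Fintype.linearCombination_apply, sum_coe_smul_of_supported I d hdI]
    exact mem_relationSpace.1 hd
  have h1 := LinearMap.finrank_range_add_finrank_ker
    (Fintype.linearCombination k fun i : I => v i)
  rw [Fintype.range_linearCombination, Module.finrank_fintype_fun_eq_card,
    Fintype.card_coe] at h1
  have h2 : Submodule.span k (v '' (I : Set ι)) =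
      Submodule.span k (Set.range fun i : I => v i) := by
    rw [Set.image_eq_range]; rfl
  have hne : (⟨fun i : I => p i, hker p hp hpI⟩ :
      LinearMap.ker (Fintype.linearCombination k fun i : I => v i)) ≠ 0 := by
    intro h
    apply hp0
    ext i
    by_cases hi : i ∈ I
    · exact congrFun (congrArg Subtype.val h) ⟨i, hi⟩
    · exact hpI i hi
  have h3 := finrank_eq_one_iff_of_nonzero' (K := k) _ hne
  rw [h2, ← h1, add_right_inj, eq_comm, h3]
  constructor
  · intro h d hd hdI
    obtain ⟨t, ht⟩ := h ⟨_, hker d hd hdI⟩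
    refine ⟨t, ?_⟩
    ext i
    by_cases hi : i ∈ I
    · exact congrFun (congrArg Subtype.val ht) ⟨i, hi⟩
    · simp [hpI i hi, hdI i hi]
  · rintro h ⟨c, hc⟩
    rw [LinearMap.mem_ker, Fintype.linearCombination_apply] at hc
    obtain ⟨t, ht⟩ := h (fun i => if h : i ∈ I then c ⟨i, h⟩ else 0)
      (mem_relationSpace.2 (by rw [sum_dite_smul, hc])) (fun i hi => dif_neg hi)
    refine ⟨t, Subtype.ext (funext fun i => ?_)⟩
    have := congrFun ht i
    simpa using this

end RelationSpaces

/-! ### Subspaces with nonnegative vectors and their elementary vectors -/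

section NonnegRelations

variable {k ι : Type*} [Field k] [LinearOrder k]

/-- Every nonzero vector of `R` has a nonnegative nonzero vector of `R` in its support. -/
def HasNonnegVectors (R : Submodule k (ι → k)) : Prop :=
  ∀ d ∈ R, d ≠ 0 → ∃ p ∈ R, 0 ≤ p ∧ p ≠ 0 ∧ ∀ i, d i = 0 → p i = 0

/-- The nonnegative nonzero vectors of `R` whose support is minimal. -/
def IsElementaryVector (R : Submodule k (ι → k)) (p : ι → k) : Prop :=
  (p ∈ R ∧ 0 ≤ p ∧ p ≠ 0) ∧
    ∀ q ∈ R, 0 ≤ q → q ≠ 0 → (∀ i, p i = 0 → q i = 0) → ∀ i, q i = 0 → p i = 0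

/-- Restrict d to a block where it is nonzero. This block is not `I o`, so the restriction is a
nonzero multiple of the block's nonnegative generator, whose support therefore lies in that of d. -/
theorem hasNonnegVectors_of_partition [DecidableEq ι] {κ : Type*} {I : κ → Finset ι}
    {R : Submodule k (ι → k)} (o : κ)
    (hcover : ∀ i, ∃ j, i ∈ I j)
    (hres : ∀ d ∈ R, ∀ j, restrictTo (I j) d ∈ R)
    (h0 : ∀ d ∈ R, (∀ i, i ∉ I o → d i = 0) → d = 0)
    (h1 : ∀ j, j ≠ o → ∃ p ∈ R, p ≠ 0 ∧ 0 ≤ p ∧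
      ∀ d ∈ R, (∀ i, i ∉ I j → d i = 0) → ∃ t : k, t • p = d) :
    HasNonnegVectors R := by
  intro d hd hd0
  obtain ⟨i, hi⟩ := Function.ne_iff.1 hd0
  obtain ⟨j, hj⟩ := hcover i
  have hz : ∀ m, m ∉ I j → restrictTo (I j) d m = 0 := fun m hm => if_neg hm
  have hne : restrictTo (I j) d ≠ 0 := fun h => hi (by
    have := congrFun h i
    rwa [restrictTo_apply, if_pos hj] at this)
  have hjo : j ≠ o := by
    rintro rfl
    exact hne (h0 _ (hres d hd j) hz)
  obtain ⟨p, hp, hpne, hp0, hall⟩ := h1 j hjo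
  obtain ⟨t, ht⟩ := hall _ (hres d hd j) hz
  refine ⟨p, hp, hp0, hpne, fun m hm => ?_⟩
  have ht0 : t ≠ 0 := by
    rintro rfl
    exact hne (by rw [← ht, zero_smul])
  have := congrFun ht m
  rw [restrictTo_apply, hm, ite_self] at this
  exact (mul_eq_zero.1 this).resolve_left ht0

variable [Fintype ι] {R : Submodule k (ι → k)}

theorem exists_isElementaryVector {p : ι → k} (hp : p ∈ R) (hp0 : 0 ≤ p) (hne : p ≠ 0) :
    ∃ q, IsElementaryVector R q ∧ ∀ i, p i = 0 → q i = 0 := by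
  classical
  induction hN : (Finset.univ.filter fun i => p i ≠ 0).card using Nat.strong_induction_on
    generalizing p with
  | _ N ih =>
    by_cases h : IsElementaryVector R p
    · exact ⟨p, h, fun _ => id⟩
    · simp only [IsElementaryVector, hp, hp0, hne, ne_eq, not_false_eq_true, and_self, true_and,
        not_forall] at h
      obtain ⟨q, hq, hq0, hqne, hqp, i, hqi, hpi⟩ := h
      have hlt : (Finset.univ.filter fun i => q i ≠ 0).card < N := by
        rw [← hN]
        refine Finset.card_lt_card (Finset.ssubset_iff_of_subset ?_ |>.2 ⟨i, ?_, ?_⟩)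
        · intro l hl
          simp only [Finset.mem_filter, Finset.mem_univ, true_and] at hl ⊢
          exact fun h => hl (hqp l h)
        · simpa using hpi
        · simpa using hqi
      obtain ⟨q', hq', hq'q⟩ := ih _ hlt hq hq0 hqne rfl
      exact ⟨q', hq', fun l hl => hq'q l (hqp l hl)⟩

theorem HasNonnegVectors.exists_elementary (hR : HasNonnegVectors R) {d : ι → k} (hd : d ∈ R)
    (hd0 : d ≠ 0) : ∃ p, IsElementaryVector R p ∧ ∀ i, d i = 0 → p i = 0 := by
  obtain ⟨p, hp, hp0, hpne, hpd⟩ := hR d hd hd0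
  obtain ⟨q, hq, hqp⟩ := exists_isElementaryVector hp hp0 hpne
  exact ⟨q, hq, fun i hi => hqp i (hpd i hi)⟩

/-- Subtract the multiple of p that kills coordinate j. A nonzero difference would contain a
nonnegative vector supported in the support of p without j, against minimality. -/
theorem IsElementaryVector.exists_smul_eq (hR : HasNonnegVectors R) {p : ι → k}
    (hp : IsElementaryVector R p) {d : ι → k} (hd : d ∈ R) (hdp : ∀ i, p i = 0 → d i = 0) :
    ∃ t : k, t • p = d := by
  obtain ⟨j, hj⟩ := Function.ne_iff.1 hp.1.2.2
  refine ⟨d j / p j, ?_⟩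
  by_contra hne
  have hmem : d - (d j / p j) • p ∈ R := R.sub_mem hd (R.smul_mem _ hp.1.1)
  obtain ⟨q, hq, hq0, hqne, hqd⟩ := hR _ hmem (fun h => hne (sub_eq_zero.1 h).symm)
  refine hj (hp.2 q hq hq0 hqne (fun i hi => hqd i (by simp [hi, hdp i hi])) j (hqd j ?_))
  have : p j ≠ 0 := hj
  simp [this]

/-- Subtracting a suitable multiple of an elementary vector inside the support of d strictly shrinks
that support. -/
theorem HasNonnegVectors.le_span (hR : HasNonnegVectors R) :
    R ≤ Submodule.span k {p | IsElementaryVector R p} := by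
  classical
  intro d hd
  induction hN : (Finset.univ.filter fun i => d i ≠ 0).card using Nat.strong_induction_on
    generalizing d with
  | _ N ih =>
    by_cases hd0 : d = 0
    · rw [hd0]; exact Submodule.zero_mem _
    · obtain ⟨p, hp, hpd⟩ := hR.exists_elementary hd hd0
      obtain ⟨j, hj⟩ := Function.ne_iff.1 hp.1.2.2
      have hj' : p j ≠ 0 := hj
      have hlt : (Finset.univ.filter fun i => (d - (d j / p j) • p) i ≠ 0).card < N := by
        rw [← hN]
        refine Finset.card_lt_card (Finset.ssubset_iff_of_subset ?_ |>.2 ⟨j, ?_, ?_⟩)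
        · intro l hl
          simp only [Finset.mem_filter, Finset.mem_univ, true_and] at hl ⊢
          exact fun h => hl (by simp [h, hpd l h])
        · simpa using fun h => hj (hpd j h)
        · simp [hj']
      have h1 := ih _ hlt (R.sub_mem hd (R.smul_mem _ hp.1.1)) rfl
      have h2 := Submodule.smul_mem _ (d j / p j) (Submodule.subset_span hp :
        p ∈ Submodule.span k {p | IsElementaryVector R p})
      simpa using Submodule.add_mem _ h1 h2

variable [IsStrictOrderedRing k]

/-- A conformal form of the existence of nonnegative vectors. -/
theorem HasNonnegVectors.exists_conformal (hR : HasNonnegVectors R) {d : ι → k} (hd : d ∈ R)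
    (hd0 : d ≠ 0) :
    ∃ q ∈ R, 0 ≤ q ∧ q ≠ 0 ∧ ((∀ i, d i ≤ 0 → q i = 0) ∨ (∀ i, 0 ≤ d i → q i = 0)) := by
  classical
  induction hN : (Finset.univ.filter fun i => d i ≠ 0).card using Nat.strong_induction_on
    generalizing d with
  | _ N ih =>
    obtain ⟨p, hp, hp0, hpne, hpd⟩ := hR d hd hd0
    by_cases hne : (Finset.univ.filter fun i => 0 < d i ∧ p i ≠ 0).Nonempty
    · obtain ⟨j, hj, hmin⟩ := Finset.exists_min_image _ (fun i => d i / p i) hne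
      simp only [Finset.mem_filter, Finset.mem_univ, true_and] at hj hmin
      have hpj : 0 < p j := lt_of_le_of_ne (hp0 j) (Ne.symm hj.2)
      -- The minimal ratio: subtracting t • p kills coordinate j and reverses no sign, so a
      -- one-signed vector found for the difference also serves for d.
      set t := d j / p j with ht
      have htpos : 0 < t := div_pos hj.1 hpj
      have htj : t * p j = d j := div_mul_cancel₀ _ hj.2
      have hnonneg : ∀ i, 0 ≤ d i → 0 ≤ d i - t * p i := by
        intro i hi
        rcases (hp0 i).eq_or_lt' with h0 | h0
        · simpa [h0] using hi
        · have hdi : 0 < d i := lt_of_le_of_ne hi fun h => h0.ne' (hpd i h.symm)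
          have := hmin i ⟨hdi, h0.ne'⟩
          rw [le_div_iff₀ h0] at this
          linarith
      have hnonpos : ∀ i, d i ≤ 0 → d i - t * p i ≤ 0 := by
        intro i hi
        have := mul_nonneg htpos.le (hp0 i)
        linarith
      by_cases hz : d - t • p = 0
      · refine ⟨p, hp, hp0, hpne, Or.inl fun i hi => ?_⟩
        have h1 : d i - t * p i = 0 := congrFun hz i
        have h2 := hp0 i
        have h3 : t * p i = 0 := le_antisymm (by linarith) (mul_nonneg htpos.le h2)
        exact (mul_eq_zero.1 h3).resolve_left htpos.ne'
      · have hlt : (Finset.univ.filter fun i => (d - t • p) i ≠ 0).card < N := by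
          rw [← hN]
          refine Finset.card_lt_card (Finset.ssubset_iff_of_subset ?_ |>.2 ⟨j, ?_, ?_⟩)
          · intro l hl
            simp only [Finset.mem_filter, Finset.mem_univ, true_and] at hl ⊢
            exact fun h => hl (by simp [h, hpd l h])
          · simpa using hj.1.ne'
          · simp [htj]
        obtain ⟨q, hq, hq0, hqne, h⟩ :=
          ih _ hlt (R.sub_mem hd (R.smul_mem t hp)) hz rfl
        exact ⟨q, hq, hq0, hqne, h.imp (fun h i hi => h i (hnonpos i hi))
          (fun h i hi => h i (hnonneg i hi))⟩
    -- Here p avoids the positive coordinates of d, so it already lives on the negative ones.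
    · refine ⟨p, hp, hp0, hpne, Or.inr fun i hi => ?_⟩
      by_contra h0
      exact hne ⟨i, by simpa using ⟨lt_of_le_of_ne hi fun h => h0 (hpd i h.symm), h0⟩⟩

/-- The difference p - (p j / q j) • q vanishes at j, is positive only on the support of p and
negative only on that of q. A conformal nonnegative vector for it misses j and contradicts the
minimality of p or of q. -/
theorem IsElementaryVector.exists_smul_eq_of_common (hR : HasNonnegVectors R) {p q : ι → k}
    (hp : IsElementaryVector R p) (hq : IsElementaryVector R q) {j : ι} (hpj : p j ≠ 0)
    (hqj : q j ≠ 0) : p = (p j / q j) • q := by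
  by_contra hne
  have hpos : 0 < p j / q j := div_pos (lt_of_le_of_ne (hp.1.2.1 j) hpj.symm)
    (lt_of_le_of_ne (hq.1.2.1 j) hqj.symm)
  have hmem : p - (p j / q j) • q ∈ R := R.sub_mem hp.1.1 (R.smul_mem _ hq.1.1)
  have hj0 : (p - (p j / q j) • q) j = 0 := by simp [hqj]
  obtain ⟨w, hw, hw0, hwne, h | h⟩ := hR.exists_conformal hmem (sub_ne_zero.2 hne)
  · refine hpj (hp.2 w hw hw0 hwne (fun i hi => h i ?_) j (h j hj0.le))
    simpa [hi] using mul_nonneg hpos.le (hq.1.2.1 i)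
  · refine hqj (hq.2 w hw hw0 hwne (fun i hi => h i ?_) j (h j hj0.ge))
    simpa [hi] using hp.1.2.1 i

/-- The coordinates split into blocks supporting pairwise disjoint positive vectors of `R`,
together with a block `I 0` meeting the support of none of them. -/
theorem HasNonnegVectors.exists_partition [DecidableEq ι] (hR : HasNonnegVectors R) :
    ∃ (l : ℕ) (I : Fin (l + 1) → Finset ι),
      (Pairwise fun j m => Disjoint (I j) (I m)) ∧
      Finset.univ.biUnion I = Finset.univ ∧
      (∀ d ∈ R, ∀ j, restrictTo (I j) d ∈ R) ∧
      (∀ d ∈ R, (∀ i, i ∉ I 0 → d i = 0) → d = 0) ∧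
      ∀ j, j ≠ 0 → ∃ p ∈ R, p ≠ 0 ∧ (∀ i ∈ I j, 0 < p i) ∧ (∀ i, i ∉ I j → p i = 0) ∧
        ∀ d ∈ R, (∀ i, i ∉ I j → d i = 0) → ∃ t : k, t • p = d := by
  classical
  let supp : (ι → k) → Finset ι := fun p => Finset.univ.filter fun i => p i ≠ 0
  have hsupp : ∀ p i, i ∈ supp p ↔ p i ≠ 0 := by simp [supp]
  let C : Finset (Finset ι) := Finset.univ.filter fun S => ∃ p, IsElementaryVector R p ∧ supp p = S
  have hCp : ∀ j : Fin C.card, ∃ p, IsElementaryVector R p ∧ supp p = C.equivFin.symm j := by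
    intro j
    exact (Finset.mem_filter.1 (C.equivFin.symm j).2).2
  choose p hp hps using hCp
  have hC : ∀ q, IsElementaryVector R q → ∃ j, supp q = supp (p j) := by
    intro q hq
    have : supp q ∈ C := by simpa [C] using ⟨q, hq, rfl⟩
    exact ⟨C.equivFin ⟨_, this⟩, by rw [hps]; simp⟩
  have heq : ∀ q q', IsElementaryVector R q → IsElementaryVector R q' → ∀ i, i ∈ supp q →
      i ∈ supp q' → supp q = supp q' := by
    intro q q' hq hq' i hi hi'
    rw [hsupp] at hi hi'
    have h1 := IsElementaryVector.exists_smul_eq_of_common hR hq hq' hi hi'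
    ext m
    rw [hsupp, hsupp, h1]
    simp [hi, hi']
  let B : Fin C.card → Finset ι := fun j => supp (p j)
  have hB : Pairwise fun j m => Disjoint (B j) (B m) := by
    intro j m hjm
    rw [Finset.disjoint_left]
    intro i hi hi'
    have := heq _ _ (hp j) (hp m) i hi hi'
    rw [hps, hps] at this
    exact hjm (C.equivFin.symm.injective (Subtype.ext this))
  have h0 : ∀ j, Disjoint (Finset.univ.biUnion B)ᶜ (B j) := by
    intro j
    rw [Finset.disjoint_left]
    intro i hi hi'
    exact (Finset.mem_compl.1 hi) (Finset.mem_biUnion.2 ⟨j, Finset.mem_univ _, hi'⟩)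
  -- Index 0 receives the coordinates outside all elementary supports.
  refine ⟨C.card, Fin.cons (Finset.univ.biUnion B)ᶜ B, ?_, ?_, ?_, ?_, ?_⟩
  · intro j m hjm
    induction j using Fin.cases with
    | zero =>
      induction m using Fin.cases with
      | zero => exact absurd rfl hjm
      | succ m => exact h0 m
    | succ j =>
      induction m using Fin.cases with
      | zero => exact (h0 j).symm
      | succ m => exact hB fun h => hjm (congrArg Fin.succ h)
  · ext i
    simp only [Finset.mem_biUnion, Finset.mem_univ, true_and, iff_true]
    by_cases hi : ∃ j, i ∈ B j
    · obtain ⟨j, hj⟩ := hi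
      exact ⟨j.succ, hj⟩
    · exact ⟨0, by simpa using hi⟩
  · intro d hd j
    -- Elementary vectors span R, so stability under restriction need only be checked on them; each
    -- is either kept or killed by a block.
    have hle : Submodule.span k {p | IsElementaryVector R p} ≤ R.comap
        (restrictTo ((Fin.cons (Finset.univ.biUnion B)ᶜ B : Fin (C.card + 1) → Finset ι) j)) := by
      rw [Submodule.span_le]
      intro q hq
      obtain ⟨m, hm⟩ := hC q hq
      have key : ∀ S : Finset ι, (S = B m ∨ Disjoint S (B m)) → restrictTo S q ∈ R := by
        rintro S (rfl | hS)
        · convert hq.1.1 using 1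
          ext i
          rw [restrictTo_apply, ite_eq_left_iff]
          intro hi
          by_contra h
          refine hi (show i ∈ supp (p m) from ?_)
          rw [← hm, hsupp]
          exact Ne.symm h
        · convert R.zero_mem using 1
          ext i
          rw [restrictTo_apply]
          refine ite_eq_right_iff.2 fun hi => ?_
          by_contra h
          exact Finset.disjoint_left.1 hS hi (show i ∈ supp (p m) from hm ▸ (hsupp q i).2 h)
      apply key
      induction j using Fin.cases with
      | zero => exact Or.inr (h0 m)
      | succ j =>
        rcases eq_or_ne j m with rfl | hjm
        · exact Or.inl rfl
        · exact Or.inr (hB hjm)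
    exact hle (hR.le_span hd)
  · intro d hd hd0
    by_contra hne
    obtain ⟨q, hq, hqd⟩ := hR.exists_elementary hd hne
    obtain ⟨m, hm⟩ := hC q hq
    obtain ⟨i, hi⟩ := Function.ne_iff.1 hq.1.2.2
    have him : i ∈ B m := show i ∈ supp (p m) from hm ▸ (hsupp q i).2 hi
    exact hi (hqd i (hd0 i fun h => Finset.disjoint_left.1 (h0 m) h him))
  · intro j hj
    obtain ⟨m, rfl⟩ := Fin.exists_succ_eq.2 hj
    refine ⟨p m, (hp m).1.1, (hp m).1.2.2, ?_, ?_, ?_⟩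
    · intro i hi
      exact lt_of_le_of_ne ((hp m).1.2.1 i) ((hsupp (p m) i).1 hi).symm
    · intro i hi
      by_contra h
      exact hi ((hsupp (p m) i).2 h)
    · intro d hd hdm
      refine (hp m).exists_smul_eq hR hd fun i hi => hdm i fun h => ?_
      exact (hsupp (p m) i).1 h hi

end NonnegRelations

/-! ### Zero in the convex hull and its relative interior -/

section ConvexHullInterior

theorem exists_nonneg_relation_of_zero_mem_convexHull {k ι E : Type*} [Field k] [LinearOrder k]
    [IsStrictOrderedRing k] [Fintype ι] [DecidableEq ι] [AddCommGroup E] [Module k E] (v : ι → E)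
    (I : Finset ι) (h : (0 : E) ∈ convexHull k (v '' (I : Set ι))) :
    ∃ p ∈ relationSpace (k := k) v, p ≠ 0 ∧ 0 ≤ p ∧ ∀ i, i ∉ I → p i = 0 := by
  have hle : convexHull k (v '' (I : Set ι)) ⊆
      {x | ∃ p : ι → k, 0 ≤ p ∧ (∀ i, i ∉ I → p i = 0) ∧ ∑ i, p i = 1 ∧ ∑ i, p i • v i = x} := by
    refine convexHull_min ?_ ?_
    · rintro _ ⟨i, hi, rfl⟩
      refine ⟨Pi.single i 1, Pi.single_nonneg.2 zero_le_one, fun j hj => ?_, ?_, ?_⟩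
      · exact Pi.single_eq_of_ne (fun h => hj (by rw [h]; exact hi)) _
      · simp
      · simp [Pi.single_apply, ite_smul]
    · rintro x ⟨p, hp, hpI, hp1, rfl⟩ y ⟨q, hq, hqI, hq1, rfl⟩ a c ha hc hac
      refine ⟨a • p + c • q, add_nonneg (smul_nonneg ha hp) (smul_nonneg hc hq), fun i hi => ?_,
        ?_, ?_⟩
      · simp [hpI i hi, hqI i hi]
      · simp [Finset.sum_add_distrib, ← Finset.mul_sum, hp1, hq1, hac]
      · simp [add_smul, Finset.sum_add_distrib, Finset.smul_sum, mul_smul]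
  obtain ⟨p, hp, hpI, hp1, hp0⟩ := hle h
  refine ⟨p, mem_relationSpace.2 hp0, ?_, hp, hpI⟩
  rintro rfl
  simp at hp1

theorem zero_mem_convexHull_of_mem_convexHullInterior {r : ℕ} {A : Set (Fin r → ℚ)}
    (h : (0 : Fin r → ℚ) ∈ convexHullInterior A) : (0 : Fin r → ℚ) ∈ convexHull ℚ A := by
  obtain ⟨w, hw, hw0⟩ := h
  have h2 := interior_subset hw
  rw [← hw0]
  exact h2

/-- Points of the span get coefficients depending continuously on them, with sum 1. At the origin
these are the normalized p, all positive, so they stay positive nearby. -/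
theorem zero_mem_convexHullInterior_of_pos_relation {ι : Type*} [Fintype ι] [DecidableEq ι]
    {r : ℕ} (v : ι → Fin r → ℚ) (I : Finset ι) {p : ι → ℚ} (hp : p ∈ relationSpace v)
    (hp0 : p ≠ 0) (hpos : ∀ i ∈ I, 0 < p i) (hpI : ∀ i, i ∉ I → p i = 0) :
    (0 : Fin r → ℚ) ∈ convexHullInterior (v '' (I : Set ι)) := by
  let φ := Fintype.linearCombination ℚ (fun i : I => v i)
  have hrange : LinearMap.range φ = Submodule.span ℚ (v '' (I : Set ι)) := by
    rw [Fintype.range_linearCombination, Set.image_eq_range]; rfl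
  obtain ⟨g₀, hg₀⟩ := φ.rangeRestrict.exists_rightInverse_of_surjective φ.range_rangeRestrict
  obtain ⟨g, hg⟩ := LinearMap.exists_extend g₀
  have hsec : ∀ w ∈ Submodule.span ℚ (v '' (I : Set ι)), ∑ i : I, g w i • v i = w := by
    intro w hw
    rw [← hrange] at hw
    have h1 : g w = g₀ ⟨w, hw⟩ := LinearMap.congr_fun hg ⟨w, hw⟩
    have h2 := congrArg Subtype.val (LinearMap.congr_fun hg₀ ⟨w, hw⟩)
    rw [LinearMap.comp_apply, ← h1] at h2
    simpa [φ, Fintype.linearCombination_apply] using h2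
  have hP : 0 < ∑ i : I, p i := by
    refine Finset.sum_pos (fun i _ => hpos i i.2) ?_
    obtain ⟨i, hi⟩ := Function.ne_iff.1 hp0
    refine ⟨⟨i, ?_⟩, Finset.mem_univ _⟩
    by_contra h
    exact hi (hpI i h)
  have hpv : ∑ i : I, p i • v i = 0 := by
    rw [sum_coe_smul_of_supported I p hpI]
    exact mem_relationSpace.1 hp
  -- The section g gives linear coefficients; adding a multiple of the relation p makes the sum 1
  -- without changing the represented vector.
  let c : (Fin r → ℚ) → I → ℚ := fun w i =>
    g w i + (1 - ∑ m, g w m) / (∑ m : I, p m) * p i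
  have hgc : Continuous g := LinearMap.continuous_on_pi g
  have hgi : ∀ i, Continuous fun w => g w i := fun i => (continuous_apply i).comp hgc
  have hcc : ∀ i, Continuous fun w => c w i := by
    intro i
    exact (hgi i).add (((continuous_const.sub (continuous_finsetSum _ fun m _ => hgi m)).div_const
      _).mul continuous_const)
  refine ⟨0, ?_, rfl⟩
  rw [mem_interior_iff_mem_nhds]
  have hev : ∀ᶠ w : Submodule.span ℚ (v '' (I : Set ι)) in nhds 0, ∀ i, 0 < c w i := by
    rw [Filter.eventually_all]
    intro i
    refine (((hcc i).comp continuous_subtype_val).tendsto 0).eventually (lt_mem_nhds ?_)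
    simpa [c] using mul_pos (inv_pos.2 hP) (hpos i i.2)
  filter_upwards [hev] with w hw
  have hsum : ∑ i, c w i = 1 := by
    simp only [c, Finset.sum_add_distrib, ← Finset.mul_sum]
    rw [div_mul_cancel₀ _ hP.ne']
    ring
  have hcomb : ∑ i, c w i • v i = (w : Fin r → ℚ) := by
    simp only [c, add_smul, Finset.sum_add_distrib, hsec w w.2, mul_smul, ← Finset.smul_sum, hpv,
      smul_zero, add_zero]
  change (w : Fin r → ℚ) ∈ convexHull ℚ _
  rw [← hcomb]
  exact (convex_convexHull ℚ _).sum_mem (fun i _ => (hw i).le) hsum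
    fun i _ => subset_convexHull _ _ ⟨i, i.2, rfl⟩

end ConvexHullInterior

/-! ### Characters of the torus -/

section Characters

theorem exists_common_denominator {ι : Type*} [Fintype ι] (d : ι → ℚ) :
    ∃ (N : ℕ) (e : ι → ℤ), 0 < N ∧ ∀ i, (e i : ℚ) = N * d i := by
  classical
  refine ⟨∏ j, (d j).den, fun i => (d i).num * ∏ j ∈ Finset.univ.erase i, ((d j).den : ℤ),
    Finset.prod_pos fun j _ => (d j).den_pos, fun i => ?_⟩
  rw [← Finset.mul_prod_erase _ _ (Finset.mem_univ i)]
  push_cast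
  rw [← Rat.mul_den_eq_num]
  ring

theorem prod_zpow_eq_zpow_sum {G ι : Type*} [CommGroup G] (u : Finset ι) (x : G) (f : ι → ℤ) :
    ∏ i ∈ u, x ^ f i = x ^ ∑ i ∈ u, f i := by
  classical
  induction u using Finset.induction_on with
  | empty => simp
  | insert i u hi ih => rw [Finset.prod_insert hi, Finset.sum_insert hi, ih, zpow_add]

variable {K : Type*} [Field K]

theorem two_zpow_injective [CharZero K] :
    Function.Injective fun z : ℤ => (Units.mk0 (2 : K) two_ne_zero) ^ z := by
  rw [injective_zpow_iff_not_isOfFinOrder, isOfFinOrder_iff_pow_eq_one]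
  rintro ⟨n, hn, h⟩
  have h1 : ((2 ^ n : ℕ) : K) = (1 : ℕ) := by
    simpa using congrArg Units.val h
  have h2 : 2 ^ n = 1 := Nat.cast_injective h1
  simp at h2
  omega

namespace Torus

variable {r : ℕ}

theorem character_apply (a : Fin r → ℤ) (t : Torus K r) : character a t = ∏ j, t j ^ a j := rfl

theorem character_sum_smul {ι : Type*} (u : Finset ι) (e : ι → ℤ) (s : ι → Fin r → ℤ)
    (t : Torus K r) :
    character (∑ i ∈ u, e i • s i) t = ∏ i ∈ u, character (s i) t ^ e i := by
  classical
  induction u using Finset.induction_on with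
  | empty => simp [character_apply]
  | insert i u hi ih =>
    rw [Finset.sum_insert hi, Finset.prod_insert hi, ← ih]
    simp [character_apply, zpow_add, Finset.prod_mul_distrib, zpow_mul', Finset.prod_zpow]

theorem character_eq_one_of_eq_zero {a : Fin r → ℤ} (h : a = 0) (t : Torus K r) :
    character a t = 1 := by
  simp [h, character_apply]

theorem character_eq_one_iff [CharZero K] {a : Fin r → ℤ} :
    (character a : Torus K r →* Kˣ) = 1 ↔ a = 0 := by
  refine ⟨fun h => funext fun j => ?_, fun h => ?_⟩
  · have h1 := DFunLike.congr_fun h (Pi.mulSingle j (Units.mk0 (2 : K) two_ne_zero))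
    rw [character_apply, Finset.prod_eq_single j (fun l _ hl => by
      rw [Pi.mulSingle_eq_of_ne hl, one_zpow]) (fun h => absurd (Finset.mem_univ j) h),
      Pi.mulSingle_eq_same] at h1
    exact two_zpow_injective (K := K) (by simpa using h1)
  · ext t
    simp [h, character_apply]

/-- A left inverse of the weight map, cleared of denominators, gives cocharacters pairing with the
weights to N times the identity. Taking N-th roots of the y i in K compensates for N. -/
theorem exists_character_eq [IsAlgClosed K] {ι : Type*} [Fintype ι] [DecidableEq ι]
    {s : ι → Fin r → ℤ} (hs : LinearIndependent ℚ fun i => rationalWeight (s i)) (y : ι → Kˣ) :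
    ∃ t : Torus K r, ∀ i, character (s i) t = y i := by
  obtain ⟨g, hg⟩ := (Fintype.linearCombination ℚ fun i =>
    rationalWeight (s i)).exists_leftInverse_of_injective
      (LinearMap.ker_eq_bot'.2 fun d hd => funext (Fintype.linearIndependent_iff.1 hs d hd))
  obtain ⟨N, e, hN, he⟩ := exists_common_denominator
    fun q : ι × Fin r => g (Pi.single q.2 1) q.1
  have hdual : ∀ i k, ∑ j, e (i, j) * s k j = if i = k then (N : ℤ) else 0 := by
    intro i k
    have h1 : g (rationalWeight (s k)) = Pi.single k 1 := by
      have := LinearMap.congr_fun hg (Pi.single k 1)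
      simpa using this
    have h2 : ∑ j, (s k j : ℚ) * g (Pi.single j 1) i = if i = k then 1 else 0 := by
      have h3 : rationalWeight (s k) = ∑ j, (s k j : ℚ) • (Pi.single j 1 : Fin r → ℚ) := by
        ext l
        simp [rationalWeight, Pi.single_apply]
      rw [h3, map_sum] at h1
      have := congrFun h1 i
      simpa [Pi.single_apply] using this
    have h4 : ((∑ j, e (i, j) * s k j : ℤ) : ℚ) = N * (if i = k then 1 else 0) := by
      rw [← h2, Finset.mul_sum]
      push_cast
      exact Finset.sum_congr rfl fun j _ => by rw [he]; ring
    have h5 : ((∑ j, e (i, j) * s k j : ℤ) : ℚ) = ((if i = k then (N : ℤ) else 0 : ℤ) : ℚ) := by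
      rw [h4]; split_ifs <;> simp
    exact_mod_cast h5
  have hroot : ∀ i, ∃ z : Kˣ, z ^ N = y i := by
    intro i
    obtain ⟨z, hz⟩ := IsAlgClosed.exists_pow_nat_eq (y i : K) hN
    have hz0 : z ≠ 0 := by
      rintro rfl
      rw [zero_pow hN.ne'] at hz
      exact (y i).ne_zero hz.symm
    exact ⟨Units.mk0 z hz0, Units.ext (by simpa using hz)⟩
  choose z hz using hroot
  refine ⟨fun j => ∏ i, z i ^ e (i, j), fun k => ?_⟩
  have hswap : character (s k) (fun j => ∏ i, z i ^ e (i, j)) =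
      ∏ i, z i ^ (∑ j, e (i, j) * s k j) := by
    simp only [character_apply, ← Finset.prod_zpow, ← zpow_mul]
    rw [Finset.prod_comm]
    exact Finset.prod_congr rfl fun i _ => prod_zpow_eq_zpow_sum _ _ _
  rw [hswap, Finset.prod_eq_single k]
  · rw [hdual, if_pos rfl, zpow_natCast, hz]
  · intro i _ hi
    rw [hdual, if_neg hi, zpow_zero]
  · exact fun h => absurd (Finset.mem_univ k) h

end Torus

/-- Linear independence of characters for families with possible repetitions. -/
theorem sum_filter_character_eq_zero {G L α : Type*} [MulOneClass G] [CommRing L] [IsDomain L]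
    [DecidableEq (G →* L)] (u : Finset α) (a : α → L) (χ : α → G →* L)
    (h : ∀ g, ∑ m ∈ u, a m * χ m g = 0) (ψ : G →* L) :
    ∑ m ∈ u with χ m = ψ, a m = 0 := by
  by_cases hψ : ψ ∈ u.image χ
  · refine linearIndependent_iff'.1 (linearIndependent_monoidHom G L) (u.image χ)
      (fun ψ => ∑ m ∈ u with χ m = ψ, a m) ?_ ψ hψ
    ext g
    rw [Finset.sum_apply, Pi.zero_apply, ← h g,
      ← Finset.sum_fiberwise_of_maps_to (fun m hm => Finset.mem_image_of_mem χ hm)]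
    refine Finset.sum_congr rfl fun ψ _ => ?_
    rw [Pi.smul_apply, smul_eq_mul, Finset.sum_mul]
    exact Finset.sum_congr rfl fun m hm => by rw [(Finset.mem_filter.1 hm).2]
  · rw [Finset.filter_eq_empty_iff.2, Finset.sum_empty]
    exact fun m hm h => hψ (h ▸ Finset.mem_image_of_mem χ hm)

end Characters

/-! ### Zariski closure and polynomial functions in coordinates -/

section ZariskiClosure

variable {K V : Type*} [Field K] [AddCommGroup V] [Module K V]

theorem mem_zariskiClosure_iff {S : Set V} {x : V} :
    x ∈ zariskiClosure K S ↔
      ∀ f ∈ polynomialFunctionAlgebra K V, (∀ y ∈ S, f y = 0) → f x = 0 := by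
  constructor
  · intro h f hf hS
    exact h {v | ∀ p ∈ ({f} : Set (V → K)), p v = 0}
      ⟨⟨{f}, by simpa using hf, rfl⟩, fun y hy => by simpa using hS y hy⟩ f rfl
  · rintro h Z ⟨⟨F, hF, rfl⟩, hS⟩ f hf
    exact h f (hF hf) fun y hy => hS hy f hf

theorem exists_mvPolynomial_of_mem_polynomialFunctionAlgebra {ι : Type*} [Fintype ι]
    (b : Module.Basis ι K V) {f : V → K} (hf : f ∈ polynomialFunctionAlgebra K V) :
    ∃ F : MvPolynomial ι K, ∀ x, f x = MvPolynomial.eval (fun i => b.repr x i) F := by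
  induction hf using Algebra.adjoin_induction with
  | mem f hf =>
    obtain ⟨g, rfl⟩ := hf
    refine ⟨∑ i, MvPolynomial.C (g (b i)) * MvPolynomial.X i, fun x => ?_⟩
    change g x = _
    conv_lhs => rw [← b.sum_repr x, map_sum]
    simp [mul_comm]
  | algebraMap c => exact ⟨MvPolynomial.C c, fun x => by simp⟩
  | add f g _ _ hf hg =>
    obtain ⟨F, hF⟩ := hf
    obtain ⟨G, hG⟩ := hg
    exact ⟨F + G, fun x => by simp [hF, hG]⟩
  | mul f g _ _ hf hg =>
    obtain ⟨F, hF⟩ := hf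
    obtain ⟨G, hG⟩ := hg
    exact ⟨F * G, fun x => by simp [hF, hG]⟩

theorem monomial_mem_polynomialFunctionAlgebra {ι : Type*} [Fintype ι]
    (b : Module.Basis ι K V) (m : ι → ℕ) :
    (fun x => ∏ i, b.repr x i ^ m i) ∈ polynomialFunctionAlgebra K V := by
  have : (fun x => ∏ i, b.repr x i ^ m i) = ∏ i, ((b.coord i : Module.Dual K V) : V → K) ^ m i := by
    ext x
    simp
  rw [this]
  exact Subalgebra.prod_mem _ fun i _ =>
    Subalgebra.pow_mem _ (Algebra.subset_adjoin (Set.mem_range_self (b.coord i))) _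

end ZariskiClosure

/-! ### Nilpotent vectors, orbits and visibility -/

section TorusRepresentations

open Representation

variable {K V : Type*} [Field K] [AddCommGroup V] [Module K V] {r n : ℕ}
  {ρ : Representation K (Torus K r) V} {s : Fin n → Fin r → ℤ} {b : Module.Basis (Fin n) K V}

theorem IsWeightBasis.repr_apply (hb : IsWeightBasis ρ s b) (t : Torus K r) (x : V) (i : Fin n) :
    b.repr (ρ t x) i = (Torus.character (s i) t : K) * b.repr x i := by
  conv_lhs => rw [← b.sum_repr x]
  simp only [map_sum, map_smul, hb t, Finsupp.coe_finsetSum, Finset.sum_apply, Finsupp.smul_apply,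
    Module.Basis.repr_self, smul_eq_mul, Finsupp.single_apply]
  rw [Finset.sum_eq_single i (fun j _ hj => by simp [hj])
    (fun h => absurd (Finset.mem_univ i) h)]
  simp [mul_comm]

theorem mem_relationSpace_rationalWeight_iff {e : Fin n → ℤ} :
    (fun i => (e i : ℚ)) ∈ relationSpace (fun i => rationalWeight (s i)) ↔
      ∑ i, e i • s i = 0 := by
  rw [mem_relationSpace, funext_iff, funext_iff]
  refine forall_congr' fun j => ?_
  simp only [Finset.sum_apply, Pi.smul_apply, rationalWeight, smul_eq_mul, Pi.zero_apply]
  exact_mod_cast Iff.rfl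

/-- An integral multiple of a rational relation between the weights. -/
theorem exists_integral_relation {d : Fin n → ℚ}
    (hd : d ∈ relationSpace (fun i => rationalWeight (s i))) :
    ∃ (N : ℕ) (e : Fin n → ℤ), 0 < N ∧ (∀ i, (e i : ℚ) = N * d i) ∧ ∑ i, e i • s i = 0 := by
  obtain ⟨N, e, hN, he⟩ := exists_common_denominator d
  refine ⟨N, e, hN, he, mem_relationSpace_rationalWeight_iff.1 ?_⟩
  have : (fun i => (e i : ℚ)) = (N : ℚ) • d := funext he
  rw [this]
  exact Submodule.smul_mem _ _ hd

/-- A vector is nilpotent if and only if no nonconstant invariant monomial is nonzero at it. -/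
theorem IsWeightBasis.isNilpotentVector_iff [CharZero K] (hb : IsWeightBasis ρ s b) {x : V} :
    ρ.IsNilpotentVector x ↔ ∀ m : Fin n → ℕ, ∑ i, (m i : ℤ) • s i = 0 →
      (∀ i, b.repr x i = 0 → m i = 0) → m = 0 := by
  classical
  rw [IsNilpotentVector, mem_zariskiClosure_iff]
  constructor
  · intro h m hm hx
    by_contra hne
    obtain ⟨j, hj⟩ := Function.ne_iff.1 hne
    -- The invariant monomial minus its value at x vanishes on the orbit, hence at 0, although that
    -- value is nonzero.
    have hmem := Subalgebra.sub_mem _ (monomial_mem_polynomialFunctionAlgebra b m)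
      (Subalgebra.algebraMap_mem (polynomialFunctionAlgebra K V) (∏ i, b.repr x i ^ m i))
    have h0 := h _ hmem ?_
    · simp only [Pi.sub_apply, Pi.algebraMap_apply, Algebra.algebraMap_self, RingHom.id_apply,
        map_zero, Finsupp.coe_zero, Pi.zero_apply] at h0
      rw [Finset.prod_eq_zero (Finset.mem_univ j) (zero_pow hj), zero_sub, neg_eq_zero,
        Finset.prod_eq_zero_iff] at h0
      obtain ⟨i, _, hi⟩ := h0
      by_cases hmi : m i = 0
      · simp [hmi] at hi
      · exact hmi (hx i (pow_eq_zero_iff hmi |>.1 hi))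
    · rintro _ ⟨t, rfl⟩
      have h1 : ∏ i, (Torus.character (s i) t : K) ^ m i = 1 := by
        have := Torus.character_sum_smul Finset.univ (fun i => (m i : ℤ)) s t
        rw [hm, Torus.character_eq_one_of_eq_zero rfl] at this
        simpa using (congrArg Units.val this).symm
      simp only [Pi.sub_apply, Pi.algebraMap_apply, Algebra.algebraMap_self, RingHom.id_apply,
        hb.repr_apply, mul_pow, Finset.prod_mul_distrib, h1, one_mul, sub_self]
  · intro h f hf hfx
    obtain ⟨F, hF⟩ := exists_mvPolynomial_of_mem_polynomialFunctionAlgebra b hf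
    -- Along the orbit, f becomes a combination of characters. The coefficient of the trivial one
    -- vanishes, and by hypothesis only the constant term, which is f 0, contributes to it.
    let χ : (Fin n →₀ ℕ) → Torus K r →* K := fun m =>
      (Units.coeHom K).comp (Torus.character (∑ i, (m i : ℤ) • s i))
    let a : (Fin n →₀ ℕ) → K := fun m => F.coeff m * ∏ i, b.repr x i ^ m i
    have hsum : ∀ t, ∑ m ∈ F.support, a m * χ m t = 0 := by
      intro t
      rw [← hfx _ ⟨t, rfl⟩, hF, MvPolynomial.eval_eq']
      refine Finset.sum_congr rfl fun m _ => ?_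
      simp only [a, χ, MonoidHom.comp_apply, Units.coeHom_apply, Torus.character_sum_smul,
        hb.repr_apply, mul_pow, Finset.prod_mul_distrib, Units.coe_prod, zpow_natCast,
        Units.val_pow_eq_pow_val]
      ring
    have hzero := sum_filter_character_eq_zero F.support a χ hsum 1
    have ha : ∀ m, χ m = 1 → m ≠ 0 → a m = 0 := by
      intro m hm hm0
      have h1 : (Torus.character (∑ i, (m i : ℤ) • s i) : Torus K r →* Kˣ) = 1 := by
        refine MonoidHom.ext fun t => Units.ext ?_
        exact DFunLike.congr_fun hm t
      by_contra hne
      refine hm0 (DFunLike.coe_injective (h m (Torus.character_eq_one_iff.1 h1) fun i hi => ?_))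
      by_contra hmi
      refine hne ?_
      simp only [a]
      rw [Finset.prod_eq_zero (Finset.mem_univ i) (by rw [hi, zero_pow hmi]), mul_zero]
    have hχ0 : χ 0 = 1 := by
      ext t
      simp [χ, Torus.character_apply]
    have ha0 : a 0 = f 0 := by
      rw [hF]
      simp [a, MvPolynomial.constantCoeff_eq]
    rw [← ha0, ← hzero]
    refine (Finset.sum_eq_single 0 (fun m hm hm0 => ha m (Finset.mem_filter.1 hm).2 hm0) ?_).symm
    intro h0
    have : F.coeff 0 = 0 := by
      by_contra hc
      exact h0 (Finset.mem_filter.2 ⟨MvPolynomial.mem_support_iff.2 hc, hχ0⟩)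
    simp [a, this]

theorem IsWeightBasis.isNilpotentVector_of_forall_nonneg [CharZero K] (hb : IsWeightBasis ρ s b)
    {x : V} (h : ∀ p ∈ relationSpace (k := ℚ) (fun i => rationalWeight (s i)), 0 ≤ p →
      (∀ i, b.repr x i = 0 → p i = 0) → p = 0) : ρ.IsNilpotentVector x := by
  rw [hb.isNilpotentVector_iff]
  intro m hm hx
  have := h (fun i => ((m i : ℤ) : ℚ)) (mem_relationSpace_rationalWeight_iff.2 hm)
    (fun i => by simp) (fun i hi => by simp [hx i hi])
  ext i
  simpa using congrFun this i

theorem IsWeightBasis.eq_zero_of_isNilpotentVector [CharZero K] (hb : IsWeightBasis ρ s b)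
    {x : V} (hx : ρ.IsNilpotentVector x) {p : Fin n → ℚ}
    (hp : p ∈ relationSpace (fun i => rationalWeight (s i))) (hp0 : 0 ≤ p)
    (hpx : ∀ i, b.repr x i = 0 → p i = 0) : p = 0 := by
  rw [hb.isNilpotentVector_iff] at hx
  obtain ⟨N, e, hN, he, hsum⟩ := exists_integral_relation hp
  have hN' : (N : ℚ) ≠ 0 := by exact_mod_cast hN.ne'
  have he0 : ∀ i, 0 ≤ e i := by
    intro i
    have : (0 : ℚ) ≤ e i := by rw [he]; exact mul_nonneg (Nat.cast_nonneg N) (hp0 i)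
    exact_mod_cast this
  have hm := hx (fun i => (e i).toNat) (by simpa [Int.toNat_of_nonneg (he0 _)] using hsum) ?_
  · ext i
    have h1 : (e i).toNat = 0 := congrFun hm i
    have h2 : e i = 0 := le_antisymm (Int.toNat_eq_zero.1 h1) (he0 i)
    have h3 := he i
    rw [h2, Int.cast_zero, eq_comm, mul_eq_zero] at h3
    exact h3.resolve_left hN'
  · intro i hi
    have h3 := he i
    rw [hpx i hi, mul_zero] at h3
    have h4 : e i = 0 := by exact_mod_cast h3
    simp [h4]

/-- Independent weights let the torus rescale the nonzero coordinates of x arbitrarily. -/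
theorem IsWeightBasis.orbitOf_eq [IsAlgClosed K] (hb : IsWeightBasis ρ s b) {x : V}
    {S : Finset (Fin n)} (hS : ∀ i, i ∈ S ↔ b.repr x i ≠ 0)
    (hind : LinearIndependent ℚ fun i : S => rationalWeight (s i)) :
    ρ.orbitOf x = {y | ∀ i, i ∈ S ↔ b.repr y i ≠ 0} := by
  ext y
  constructor
  · rintro ⟨t, rfl⟩ i
    simp [hb.repr_apply, hS i]
  · intro hy
    obtain ⟨t, ht⟩ := Torus.exists_character_eq hind fun i =>
      Units.mk0 (b.repr y i / b.repr x i) (div_ne_zero ((hy i).1 i.2) ((hS i).1 i.2))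
    refine ⟨t, b.repr.injective (Finsupp.ext fun i => ?_)⟩
    rw [hb.repr_apply]
    by_cases hi : i ∈ S
    · rw [ht ⟨i, hi⟩]
      exact div_mul_cancel₀ _ ((hS i).1 hi)
    · rw [not_not.1 (mt (hS i).2 hi), not_not.1 (mt (hy i).2 hi), mul_zero]

theorem IsWeightBasis.isVisible_of_hasNonnegVectors [IsAlgClosed K] [CharZero K]
    (hb : IsWeightBasis ρ s b)
    (h : HasNonnegVectors (relationSpace (k := ℚ) fun i => rationalWeight (s i))) :
    ρ.IsVisible := by
  classical
  refine (Set.finite_range fun S : Finset (Fin n) =>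
    {y : V | ∀ i, i ∈ S ↔ b.repr y i ≠ 0}).subset ?_
  rintro _ ⟨x, hx, rfl⟩
  let S : Finset (Fin n) := Finset.univ.filter fun i => b.repr x i ≠ 0
  have hS : ∀ i, i ∈ S ↔ b.repr x i ≠ 0 := by simp [S]
  refine Set.mem_range.2 ⟨S, (hb.orbitOf_eq hS ?_).symm⟩
  rw [linearIndependent_coe_iff (v := fun i => rationalWeight (s i)) S]
  intro d hd hdS
  by_contra hd0
  obtain ⟨p, hp, hp0, hpne, hpd⟩ := h d hd hd0
  exact hpne (hb.eq_zero_of_isNilpotentVector hx hp hp0 fun i hi =>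
    hpd i (hdS i fun h => (hS i).1 h hi))

theorem IsWeightBasis.hasNonnegVectors_of_isVisible [CharZero K]
    (hb : IsWeightBasis ρ s b) (h : ρ.IsVisible) :
    HasNonnegVectors (relationSpace (k := ℚ) fun i => rationalWeight (s i)) := by
  classical
  intro d hd hd0
  by_contra hno
  obtain ⟨N, e, hN, he, hsum⟩ := exists_integral_relation hd
  have hN' : (N : ℚ) ≠ 0 := by exact_mod_cast hN.ne'
  have hed : ∀ i, d i = 0 ↔ e i = 0 := by
    intro i
    rw [← Int.cast_eq_zero (α := ℚ), he, mul_eq_zero, or_iff_right hN']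
  obtain ⟨j, hj⟩ := Function.ne_iff.1 hd0
  let two : Kˣ := Units.mk0 (2 : K) two_ne_zero
  -- All vectors x l share the support of d and differ only at j, where the coordinate is 2^l. The
  -- invariant Laurent monomial with exponents e then equals 2^(l * e j), which separates the orbits
  -- as e j ≠ 0.
  let u : ℕ → Fin n → Kˣ := fun l => Pi.mulSingle j (two ^ l)
  let x : ℕ → V := fun l => b.equivFun.symm fun i => if d i = 0 then 0 else (u l i : K)
  have hx : ∀ l i, b.repr (x l) i = if d i = 0 then 0 else (u l i : K) := by
    intro l i
    rw [← b.equivFun_apply, LinearEquiv.apply_symm_apply]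
  have hx0 : ∀ l i, b.repr (x l) i = 0 ↔ d i = 0 := by
    intro l i
    rw [hx]
    simp
  have hnil : ∀ l, ρ.IsNilpotentVector (x l) := by
    intro l
    refine hb.isNilpotentVector_of_forall_nonneg fun p hp hp0 hpx => ?_
    by_contra hpne
    exact hno ⟨p, hp, hp0, hpne, fun i hi => hpx i ((hx0 l i).2 hi)⟩
  have hinv : ∀ l, ∏ i, u l i ^ e i = two ^ (l * e j) := by
    intro l
    rw [Finset.prod_eq_single j
      (fun i _ hi => by simp only [u]; rw [Pi.mulSingle_eq_of_ne hi, one_zpow])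
      (fun h => absurd (Finset.mem_univ j) h)]
    simp only [u]
    rw [Pi.mulSingle_eq_same, zpow_mul, zpow_natCast]
  refine Set.infinite_of_injective_forall_mem (f := fun l => ρ.orbitOf (x l)) ?_
    (fun l => Set.mem_ofPred.2 ⟨x l, hnil l, rfl⟩) h
  intro l m hlm
  have hmem : x m ∈ ρ.orbitOf (x l) := by
    have h1 : x m ∈ ρ.orbitOf (x m) := Set.mem_range.2 ⟨1, by simp⟩
    exact (show ρ.orbitOf (x l) = ρ.orbitOf (x m) from hlm) ▸ h1
  obtain ⟨t, ht⟩ := hmem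
  have hcoord : ∀ i, (Torus.character (s i) t * u l i) ^ e i = u m i ^ e i := by
    intro i
    by_cases hi : d i = 0
    · rw [(hed i).1 hi, zpow_zero, zpow_zero]
    · congr 1
      have h1 : b.repr (ρ t (x l)) i = b.repr (x m) i := by rw [← ht]
      rw [hb.repr_apply, hx, hx, if_neg hi, if_neg hi] at h1
      exact Units.ext (by simpa using h1)
  have hprod : ∏ i, (Torus.character (s i) t * u l i) ^ e i = ∏ i, u m i ^ e i :=
    Finset.prod_congr rfl fun i _ => hcoord i
  simp only [mul_zpow, Finset.prod_mul_distrib] at hprod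
  rw [← Torus.character_sum_smul, hsum, Torus.character_eq_one_of_eq_zero rfl, one_mul, hinv,
    hinv] at hprod
  have h2 := two_zpow_injective hprod
  have h3 : e j ≠ 0 := fun h => hj ((hed j).2 h)
  exact_mod_cast mul_right_cancel₀ h3 h2

end TorusRepresentations

theorem mainTheorem6 {K : Type*} [Field K] [IsAlgClosed K] [CharZero K]
    {V : Type*} [AddCommGroup V] [Module K V] {r n : ℕ}
    (ρ : Representation K (Torus K r) V) (s : Fin n → Fin r → ℤ)
    (b : Module.Basis (Fin n) K V) (hb : IsWeightBasis ρ s b) :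
    ρ.IsVisible ↔
      ∃ (l : ℕ) (I : Fin (l + 1) → Finset (Fin n)),
        (Pairwise fun j k => Disjoint (I j) (I k)) ∧
        (Finset.univ.biUnion I = Finset.univ) ∧
        (iSupIndep (fun j => Submodule.span ℚ (weightSet s (I j))) ∧
          Submodule.span ℚ (weightSet s Finset.univ) =
            ⨆ j, Submodule.span ℚ (weightSet s (I j))) ∧
        (Module.finrank ℚ (Submodule.span ℚ (weightSet s (I 0))) = (I 0).card ∧
          ∀ j, j ≠ 0 →
            Module.finrank ℚ (Submodule.span ℚ (weightSet s (I j))) + 1 = (I j).card) ∧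
        (∀ j, j ≠ 0 → (0 : Fin r → ℚ) ∈ convexHullInterior (weightSet s (I j))) := by
  constructor
  · intro h
    obtain ⟨l, I, hdisj, hcover, hres, h0, h1⟩ :=
      (hb.hasNonnegVectors_of_isVisible h).exists_partition
    refine ⟨l, I, hdisj, hcover, ⟨iSupIndep_span_of_restrictTo_mem hdisj hres, ?_⟩,
      ⟨(finrank_span_image_eq_card_iff (I 0)).2 h0, ?_⟩, ?_⟩
    · rw [← Submodule.span_iUnion, ← hcover]
      simp only [weightSet, Finset.coe_biUnion, Finset.coe_univ, Set.mem_univ, Set.iUnion_true,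
        Set.image_iUnion]
    · intro j hj
      obtain ⟨p, hp, hpne, _, hpI, hall⟩ := h1 j hj
      exact (finrank_span_image_add_one_eq_card_iff (I j) hp hpI hpne).2 hall
    · intro j hj
      obtain ⟨p, hp, hpne, hpos, hpI, _⟩ := h1 j hj
      exact zero_mem_convexHullInterior_of_pos_relation _ (I j) hp hpne hpos hpI
  · rintro ⟨l, I, hdisj, hcover, ⟨hind, _⟩, ⟨h0, h1⟩, hint⟩
    refine hb.isVisible_of_hasNonnegVectors (hasNonnegVectors_of_partition (I := I) 0 ?_ ?_ ?_ ?_)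
    · intro i
      have : i ∈ Finset.univ.biUnion I := hcover ▸ Finset.mem_univ i
      simpa using this
    · exact fun d hd j => restrictTo_mem_of_iSupIndep_span hdisj hcover hind hd j
    · exact (finrank_span_image_eq_card_iff (I 0)).1 h0
    · intro j hj
      obtain ⟨p, hp, hpne, hp0, hpI⟩ := exists_nonneg_relation_of_zero_mem_convexHull _ (I j)
        (zero_mem_convexHull_of_mem_convexHullInterior (hint j hj))
      exact ⟨p, hp, hpne, hp0,
        (finrank_span_image_add_one_eq_card_iff (I j) hp hpI hpne).1 (h1 j hj)⟩
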